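/- Let $d\ge 1$, $m\ge 0$, let $X$ be a random vector in $\mathbb{R}^d$ and $\epsilon$ a random vector in $\mathbb{R}^m$, independent of $X$, let $g:\mathbb{R}^d\times\mathbb{R}^m\to\mathbb{R}$ be measurable, and put $Y=g(X,\epsilon)$ and $Y^x=g(x,\epsilon)$. Let $(X_n,\epsilon_n)_{n\ge1}$ be i.i.d. copies of $(X,\epsilon)$ and $Y_n=g(X_n,\epsilon_n)$. Write $F_Z$ for the cumulative distribution function of $Z$. Fix a level $\alpha\in[1/2,1)$ and a point $x$ in the support of the law of $X$, and let $\theta^*(x)=\inf\{t\in\mathbb{R}: F_{Y^x}(t)\ge\alpha\}$ be the conditional quantile. Assume: - (A1) there is a constant $M(x)$ such that, for every ball $B$ centred at $x$ with radius $r_B>0$ and every $t\in\mathbb{R}$, $|F_{Y^B}(t)-F_{Y^x}(t)|\le M(x)\,r_B$, where $Y^B$ has the conditional law of $Y$ given $X\in B$; - (A2) the law of $X$ has a density with respect to Lebesgue measure, and this density is at least some constant $C_{input}>0$ on the support of the law of $X$; - the conditional quantile of level $\alpha$ is unique: $F_{Y^x}(t)>\alpha$ for every $t>\theta^*(x)$.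 Let $\frac12<\gamma\le\beta<1$, $k_n=\lfloor n^\beta\rfloor$, $\gamma_n=n^{-\gamma}$, let $\theta_0(x)\in\mathbb{R}$ be arbitrary, and for $n\ge0$ $$\theta_{n+1}(x)=\theta_n(x)-\gamma_{n+1}\left(\mathbf 1_{Y_{n+1}\le\theta_n(x)}-\alpha\right)\mathbf 1_{\|X_{n+1}-x\|\le\|X-x\|_{(k_{n+1},n)}},$$ where $\|\cdot\|$ is the Euclidean norm and $\|X-x\|_{(k,n)}$ is the $k$-th order statistic (the $k$-th smallest value) of $\|X_1-x\|,\dots,\|X_n-x\|$. For $n=0$, where there is no earlier observation, it is read as $+\infty$, so that $X_1$ counts as a neighbour; for $n\ge1$ one has $1\le k_{n+1}\le n$. Then $\theta_n(x)\to\theta^*(x)$ almost surely as $n\to\infty$. -/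

import Mathlib

open MeasureTheory ProbabilityTheory Filter Topology
open scoped ENNReal

namespace KNNQuantile

noncomputable section

/-- The quantile of level `α` of a law `ν` on the real line: `inf {t : F(t) ≥ α}`, where `F` is
the cumulative distribution function of `ν`. -/
def quantile (ν : Measure ℝ) (α : ℝ) : ℝ :=
  sInf {t : ℝ | α ≤ cdf ν t}

section Code

variable {d m : ℕ}

/-- The law of `Y^x = g(x, ε)`, when the random seed `ε` has law `με`. -/
def lawAt (με : Measure (EuclideanSpace ℝ (Fin m)))
    (g : EuclideanSpace ℝ (Fin d) → EuclideanSpace ℝ (Fin m) → ℝ)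
    (x : EuclideanSpace ℝ (Fin d)) : Measure ℝ :=
  με.map (g x)

/-- The law of `Y^B`, i.e. the conditional law of `Y = g(X, ε)` given `X ∈ B`, when `X` and `ε` are
independent with laws `μX` and `με`. -/
def lawOn (μX : Measure (EuclideanSpace ℝ (Fin d))) (με : Measure (EuclideanSpace ℝ (Fin m)))
    (g : EuclideanSpace ℝ (Fin d) → EuclideanSpace ℝ (Fin m) → ℝ)
    (B : Set (EuclideanSpace ℝ (Fin d))) : Measure ℝ :=
  (ProbabilityTheory.cond (μX.prod με) (Prod.fst ⁻¹' B)).map (fun p => g p.1 p.2)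

/-- Assumption A1 at the point `x`: there is a constant `M` such that
`|F_{Y^B}(t) - F_{Y^x}(t)| ≤ M r` for every real `t` and every ball `B` centred at `x`, of
radius `r > 0`. -/
def AssumptionA1 (μX : Measure (EuclideanSpace ℝ (Fin d)))
    (με : Measure (EuclideanSpace ℝ (Fin m)))
    (g : EuclideanSpace ℝ (Fin d) → EuclideanSpace ℝ (Fin m) → ℝ)
    (x : EuclideanSpace ℝ (Fin d)) : Prop :=
  ∃ M : ℝ, ∀ r : ℝ, 0 < r → ∀ t : ℝ,
    |cdf (lawOn μX με g (Metric.closedBall x r)) t - cdf (lawAt με g x) t| ≤ M * r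

/-- Assumption A2: the law of `X` has a density with respect to Lebesgue measure, and this density
is bounded below by a positive constant on the support of `X`. -/
def AssumptionA2 (μX : Measure (EuclideanSpace ℝ (Fin d))) : Prop :=
  ∃ f : EuclideanSpace ℝ (Fin d) → ℝ≥0∞, Measurable f ∧ μX = volume.withDensity f ∧
    ∃ C : ℝ, 0 < C ∧ ∀ z ∈ μX.support, ENNReal.ofReal C ≤ f z

end Code

/-- The `k`-th order statistic of `u 0, …, u (n - 1)`: the smallest `r` such that at least `k` of
these `n` values are at most `r`. If `n < k` it is `⊤`. -/
def orderStat (u : ℕ → ℝ≥0∞) (k n : ℕ) : ℝ≥0∞ :=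
  sInf {r : ℝ≥0∞ | k ≤ ((Finset.range n).filter (fun i => u i ≤ r)).card}

/-- The number of neighbours `k_n = ⌊n^β⌋`. -/
def numNeighbours (β : ℝ) (n : ℕ) : ℕ := ⌊(n : ℝ) ^ β⌋₊

/-- The learning rate `γ_n = n^{-γ}`. -/
def stepSize (γ : ℝ) (n : ℕ) : ℝ := (n : ℝ) ^ (-γ)

/-- The event `X_{n+1} ∈ kNN_{n+1}(x)`, i.e. `‖X_{n+1} - x‖ ≤ ‖X - x‖_{(k_{n+1}, n)}`.
The observations are numbered from `0` here: `X_{i+1}` is `xs i`. For `n = 0` one has `k_1 = 1`, and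
the first observation is a neighbour. -/
def IsNeighbour {d : ℕ} (β : ℝ) (x : EuclideanSpace ℝ (Fin d)) (xs : ℕ → EuclideanSpace ℝ (Fin d))
    (n : ℕ) : Prop :=
  edist (xs n) x ≤ orderStat (fun i => edist (xs i) x) (numNeighbours β (n + 1)) n

open Classical in
/-- The iterates `θ_n(x)` of the algorithm started at `θ₀`, run on the observations
`(X_{i+1}, Y_{i+1}) = (xs i, ys i)`. -/
def iterate {d : ℕ} (α β γ θ₀ : ℝ) (x : EuclideanSpace ℝ (Fin d))
    (xs : ℕ → EuclideanSpace ℝ (Fin d)) (ys : ℕ → ℝ) : ℕ → ℝ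
  | 0 => θ₀
  | n + 1 =>
    iterate α β γ θ₀ x xs ys n -
      stepSize γ (n + 1) *
        ((if ys n ≤ iterate α β γ θ₀ x xs ys n then 1 else 0) - α) *
        (if IsNeighbour β x xs n then 1 else 0)

end

end KNNQuantile

/-!
# Almost sure convergence of the nearest-neighbour quantile estimate

At step `n` the state of the algorithm consists of the radius `ρ n` of the ball of the nearest
neighbours of `x` and of the current estimate `θ n`. Both are functions of the first `n` observations,
hence independent of the next one. Averaging the increment over the next observation (`increment`,
`meanIncrement`, `meanIncrement_eq`) writes the algorithm as a Robbins–Monro recursion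

  `θ (n + 1) = θ n - γ_{n+1} p n (F_n (θ n) - α) + noise`,

where `p n` is the mass of the ball of radius `ρ n` around `x` (`ballMass`) and `F_n` is the
distribution function of the output given that the input lies in this ball.

* The noise is summable: it is centred given the past and its weights `γ_{n+1}` are square-summable,
  so its partial sums are a martingale bounded in `L²` (`ae_exists_tendsto_sum_noise`).
* The bias `F_n - F`, with `F` the distribution function at `x`, is at most `M ρ n` uniformly, and
  `ρ n → 0` by the law of large numbers, since `k_n / n → 0` and `x` is in the support of the input
  (`ae_tendsto_orderStat`). No rate is needed. The density of the input excludes an atom at `x`, so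
  that a ball of positive mass has positive radius and the bound on the bias applies to it.
* The steps `γ_{n+1} p n` have infinite sum, because `p n` is eventually at least
  `(n + 1) ^ (β - 1) / 4` and `γ ≤ β` (`ae_eventually_le_ballMass`). Indeed a smaller `p n` would force
  `k_{n+1}` of the first `n` inputs into a set of at most this mass, and Hoeffding's inequality with
  the Borel–Cantelli lemma forbids this for large `n`, as `β > 1/2`.

Since `F - α` is monotone and changes sign at the quantile only, these three facts imply convergence
for each sample (`tendsto_of_robbinsMonro`).
-/

namespace KNNQuantile

/-! ### Perturbed descent along a monotone field -/

/-- If the drift is at least `η > 0` as long as `u` is above the level `c`, and the total step length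
is infinite, then `u` falls below `c`, and later overshoots `c` by no more than one step. -/
lemma eventually_le_of_drift {u a b : ℕ → ℝ} {c η δ : ℝ} (hδ : 0 < δ) (hη : 0 < η)
    (ha : ∀ n, 0 ≤ a n)
    (hdiv : Tendsto (fun n => ∑ i ∈ Finset.range n, a i) atTop atTop)
    (hsmall : ∀ᶠ n in atTop, |a n * b n| ≤ δ)
    (hu : ∀ᶠ n in atTop, u (n + 1) = u n - a n * b n)
    (hb : ∀ᶠ n in atTop, c ≤ u n → η ≤ b n) : ∀ᶠ n in atTop, u n ≤ c + δ := by
  obtain ⟨N, hN⟩ := eventually_atTop.1 (hsmall.and (hu.and hb))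
  obtain ⟨n₀, hn₀, hlt⟩ : ∃ n ≥ N, u n ≤ c + δ := by
    by_contra! hcon
    have hstep : ∀ n ≥ N, u n ≤ u N - η * (∑ i ∈ Finset.range n, a i
        - ∑ i ∈ Finset.range N, a i) := by
      intro n hn
      induction n, hn using Nat.le_induction with
      | base => simp
      | succ n hn ih =>
        have h1 := (hN n hn).2.2 (by linarith [hcon n hn])
        rw [(hN n hn).2.1, Finset.sum_range_succ]
        nlinarith [mul_le_mul_of_nonneg_left h1 (ha n)]
    obtain ⟨n, hn, hge⟩ := ((eventually_ge_atTop N).and (hdiv.eventually_ge_atTop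
      ((u N - c) / η + ∑ i ∈ Finset.range N, a i))).exists
    have h2 : (u N - c) / η ≤ ∑ i ∈ Finset.range n, a i - ∑ i ∈ Finset.range N, a i := by
      linarith
    rw [div_le_iff₀ hη] at h2
    linarith [hstep n hn, hcon n hn, mul_comm η (∑ i ∈ Finset.range n, a i
        - ∑ i ∈ Finset.range N, a i)]
  refine eventually_atTop.2 ⟨n₀, fun n hn => ?_⟩
  induction n, hn using Nat.le_induction with
  | base => exact hlt
  | succ n hn ih =>
    obtain ⟨h1, h2, h3⟩ := hN n (hn₀.trans hn)
    rw [h2]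
    by_cases hc : c ≤ u n
    · have := mul_nonneg (ha n) (hη.le.trans (h3 hc))
      linarith
    · linarith [neg_abs_le (a n * b n)]

/-- Deterministic convergence of a Robbins–Monro recursion: the noise `e` is summable, the steps
`a` tend to zero and have infinite sum, and the drift `b` is asymptotically `h (θ n)`, for a monotone
`h` which changes sign at `θs` only. -/
theorem tendsto_of_robbinsMonro {θ a b e : ℕ → ℝ} {h : ℝ → ℝ} {θs S : ℝ} (hmono : Monotone h)
    (hneg : ∀ t < θs, h t < 0) (hpos : ∀ t, θs < t → 0 < h t)
    (ha : ∀ n, 0 ≤ a n) (ha0 : Tendsto a atTop (𝓝 0))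
    (hdiv : Tendsto (fun n => ∑ i ∈ Finset.range n, a i) atTop atTop)
    (hb1 : ∀ᶠ n in atTop, |b n| ≤ 1)
    (hb : Tendsto (fun n => b n - h (θ n)) atTop (𝓝 0))
    (hrec : ∀ᶠ n in atTop, θ (n + 1) = θ n - a n * b n + e n)
    (hS : Tendsto (fun n => ∑ i ∈ Finset.range n, e i) atTop (𝓝 S)) :
    Tendsto θ atTop (𝓝 θs) := by
  -- Removing the noise leaves a recursion driven by `b` alone, asymptotic to `θ`.
  set u : ℕ → ℝ := fun n => θ n - (∑ i ∈ Finset.range n, e i - S) with hu_def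
  have hS0 : Tendsto (fun n => ∑ i ∈ Finset.range n, e i - S) atTop (𝓝 0) := by
    simpa using hS.sub_const S
  have hu : ∀ᶠ n in atTop, u (n + 1) = u n - a n * b n := by
    filter_upwards [hrec] with n hn
    simp only [hu_def, hn, Finset.sum_range_succ]
    ring
  have hsmall : ∀ δ > 0, ∀ᶠ n in atTop, |a n * b n| ≤ δ := by
    intro δ hδ
    filter_upwards [hb1, ha0.eventually_le_const hδ] with n h1 h2
    rw [abs_mul, abs_of_nonneg (ha n)]
    nlinarith [ha n, abs_nonneg (b n)]
  have hlim : Tendsto u atTop (𝓝 θs) := by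
    rw [Metric.tendsto_nhds]
    intro δ hδ
    have hup : ∀ᶠ n in atTop, u n ≤ (θs + δ / 3) + δ / 3 := by
      have hη := hpos (θs + δ / 6) (by linarith)
      refine eventually_le_of_drift (by positivity) (half_pos hη) ha hdiv (hsmall _ (by positivity))
        hu ?_
      filter_upwards [hS0.eventually_const_le (show -(δ / 6) < 0 by linarith),
        hb.eventually_const_le (show -(h (θs + δ / 6) / 2) < 0 by linarith)] with n h1 h2 h3
      have : h (θs + δ / 6) ≤ h (θ n) := hmono (by simp only [hu_def] at h3; linarith)
      linarith
    have hlow : ∀ᶠ n in atTop, -u n ≤ (-θs + δ / 3) + δ / 3 := by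
      have hη := hneg (θs - δ / 6) (by linarith)
      refine eventually_le_of_drift (u := fun n => -u n) (b := fun n => -b n)
        (η := -h (θs - δ / 6) / 2) (by positivity) (by linarith) ha hdiv
        (by simpa using hsmall (δ / 3) (by positivity)) ?_ ?_
      · filter_upwards [hu] with n hn
        rw [hn]
        ring
      filter_upwards [hS0.eventually_le_const (show 0 < δ / 6 by linarith),
        hb.eventually_le_const (show 0 < -h (θs - δ / 6) / 2 by linarith)] with n h1 h2 h3
      have : h (θ n) ≤ h (θs - δ / 6) := hmono (by simp only [hu_def] at h3; linarith)
      linarith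
    filter_upwards [hup, hlow] with n h1 h2
    rw [Real.dist_eq, abs_lt]
    constructor <;> linarith
  simpa [hu_def] using hlim.add hS0

/-! ### Order statistics -/

lemma orderStat_eq_iInf (u : ℕ → ℝ≥0∞) (k n : ℕ) :
    orderStat u k n = ⨅ T ∈ (Finset.range n).powersetCard k, ⨆ i ∈ T, u i := by
  apply le_antisymm
  · refine le_iInf₂ fun T hT => sInf_le ?_
    rw [Finset.mem_powersetCard] at hT
    change k ≤ _
    rw [← hT.2]
    refine Finset.card_le_card fun i hi => Finset.mem_filter.2 ⟨hT.1 hi, ?_⟩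
    exact le_iSup₂ (f := fun i (_ : i ∈ T) => u i) i hi
  · refine le_sInf fun r hr => ?_
    obtain ⟨T, hT, hcard⟩ := Finset.exists_subset_card_eq (show k ≤ _ from hr)
    refine (iInf₂_le T (Finset.mem_powersetCard.2
      ⟨hT.trans (Finset.filter_subset _ _), hcard⟩)).trans ?_
    exact iSup₂_le fun i hi => (Finset.mem_filter.1 (hT hi)).2

lemma measurable_orderStat {Ω : Type*} [MeasurableSpace Ω] {u : ℕ → Ω → ℝ≥0∞} {k n : ℕ}
    (hu : ∀ i < n, Measurable (u i)) :
    Measurable fun ω => orderStat (fun i => u i ω) k n := by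
  simp_rw [orderStat_eq_iInf]
  refine Measurable.biInf _ (Finset.countable_toSet _) fun T hT =>
    Measurable.biSup _ (Finset.countable_toSet _) fun i hi => hu i ?_
  exact Finset.mem_range.1 ((Finset.mem_powersetCard.1 hT).1 hi)

lemma orderStat_le {u : ℕ → ℝ≥0∞} {k n : ℕ} {r : ℝ≥0∞}
    (h : k ≤ ((Finset.range n).filter (fun i => u i ≤ r)).card) : orderStat u k n ≤ r :=
  sInf_le h

open Classical in
/-- If fewer than `k` of the indices below `n` belong to `s`, then the `k`-th order statistic is at
least one of the values of `u` outside `s`, or infinite. -/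
lemma exists_le_orderStat {u : ℕ → ℝ≥0∞} {k n : ℕ} {s : Set ℕ}
    (h : ((Finset.range n).filter (fun i => i ∈ s)).card < k) :
    orderStat u k n = ⊤ ∨ ∃ i ∉ s, u i ≤ orderStat u k n := by
  rcases ((Finset.range n).filter (fun i => i ∉ s)).eq_empty_or_nonempty with h0 | h0
  · left
    refine sInf_eq_top.2 fun r hr => ?_
    exfalso
    refine absurd (show k ≤ _ from hr) (not_le.2 (lt_of_le_of_lt (Finset.card_le_card ?_) h))
    intro i hi
    have hi' := (Finset.mem_filter.1 hi).1
    refine Finset.mem_filter.2 ⟨hi', ?_⟩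
    by_contra hs
    exact (Finset.eq_empty_iff_forall_notMem.1 h0 i) (Finset.mem_filter.2 ⟨hi', hs⟩)
  · right
    obtain ⟨i, hi, hmin⟩ := Finset.exists_min_image _ u h0
    refine ⟨i, (Finset.mem_filter.1 hi).2, le_sInf fun r hr => ?_⟩
    by_contra! hlt
    refine absurd (show k ≤ _ from hr) (not_le.2 (lt_of_le_of_lt (Finset.card_le_card ?_) h))
    intro j hj
    obtain ⟨hj1, hj2⟩ := Finset.mem_filter.1 hj
    refine Finset.mem_filter.2 ⟨hj1, ?_⟩
    by_contra hs
    exact absurd (hmin j (Finset.mem_filter.2 ⟨hj1, hs⟩)) (not_le.2 (hj2.trans_lt hlt))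

/-! ### Martingale noise -/

section Noise

variable {Ω 𝓥 𝓦 : Type*} [MeasurableSpace 𝓥] [MeasurableSpace 𝓦]

lemma integrable_of_abs_le {mΩ : MeasurableSpace Ω} {P : Measure Ω} [IsFiniteMeasure P] {f : Ω → ℝ}
    (hf : Measurable f) (K : ℝ) (hK : ∀ ω, |f ω| ≤ K) : Integrable f P :=
  Integrable.of_bound hf.aestronglyMeasurable K (ae_of_all _ hK)

/-- A function of `(V, W)` which is centred in `W` for each frozen value of `V` is orthogonal to all
bounded `m`-measurable variables, when `V` is `m`-measurable and `W` is independent of `m`. -/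
lemma integral_mul_eq_zero_of_indep {m mΩ : MeasurableSpace Ω} {P : Measure Ω}
    [IsProbabilityMeasure P] (hm : m ≤ mΩ) {U : Ω → ℝ} {V : Ω → 𝓥} {W : Ω → 𝓦}
    (hU : Measurable[m] U) (hV : Measurable[m] V) (hW : Measurable W)
    (hind : Indep m (MeasurableSpace.comap W inferInstance) P) {ψ : 𝓥 → 𝓦 → ℝ}
    (hψ : Measurable (Function.uncurry ψ)) {C K : ℝ} (hC : ∀ v w, |ψ v w| ≤ C)
    (hK : ∀ ω, |U ω| ≤ K) (h0 : ∀ v, ∫ w, ψ v w ∂(P.map W) = 0) :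
    ∫ ω, U ω * ψ (V ω) (W ω) ∂P = 0 := by
  have hU' : Measurable U := hU.mono hm le_rfl
  have hV' : Measurable V := hV.mono hm le_rfl
  have hUV : IndepFun (fun ω => (U ω, V ω)) W P :=
    (IndepFun_iff_Indep _ _ _).2 (indep_of_indep_of_le_left hind (hU.prodMk hV).comap_le)
  have hmap := (indepFun_iff_map_prod_eq_prod_map_map (hU'.prodMk hV').aemeasurable
    hW.aemeasurable).1 hUV
  set F : (ℝ × 𝓥) × 𝓦 → ℝ := fun p => p.1.1 * ψ p.1.2 p.2 with hF
  have hFm : Measurable F := by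
    have : Measurable fun p : (ℝ × 𝓥) × 𝓦 => ψ p.1.2 p.2 :=
      hψ.comp ((measurable_snd.comp measurable_fst).prodMk measurable_snd)
    exact (measurable_fst.comp measurable_fst).mul this
  have hUVW : Measurable fun ω => ((U ω, V ω), W ω) := (hU'.prodMk hV').prodMk hW
  have hint : Integrable F (P.map fun ω => ((U ω, V ω), W ω)) := by
    refine (integrable_map_measure hFm.aestronglyMeasurable hUVW.aemeasurable).2 ?_
    refine integrable_of_abs_le (hFm.comp hUVW) (K * C) fun ω => ?_
    simp only [hF, Function.comp_apply, abs_mul]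
    exact mul_le_mul (hK ω) (hC _ _) (abs_nonneg _) ((abs_nonneg _).trans (hK ω))
  calc ∫ ω, U ω * ψ (V ω) (W ω) ∂P = ∫ p, F p ∂(P.map fun ω => ((U ω, V ω), W ω)) :=
        (integral_map hUVW.aemeasurable hFm.aestronglyMeasurable).symm
    _ = 0 := by
        rw [hmap] at hint ⊢
        rw [integral_prod _ hint]
        simp [hF, integral_const_mul, h0]

/-- Almost sure convergence of a series of centred, bounded noises with square-summable weights: the
partial sums are a martingale bounded in `L²`. -/
theorem ae_exists_tendsto_sum_noise {mΩ : MeasurableSpace Ω} {P : Measure Ω}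
    [IsProbabilityMeasure P] (ℱ : Filtration ℕ mΩ) {V : ℕ → Ω → 𝓥} {W : ℕ → Ω → 𝓦}
    {ν : Measure 𝓦} (hV : ∀ n, Measurable[ℱ n] (V n)) (hW : ∀ n, Measurable[ℱ (n + 1)] (W n))
    (hlaw : ∀ n, P.map (W n) = ν)
    (hind : ∀ n, Indep (ℱ n) (MeasurableSpace.comap (W n) inferInstance) P) {ψ : 𝓥 → 𝓦 → ℝ}
    (hψ : Measurable (Function.uncurry ψ)) {C : ℝ} (hC : ∀ v w, |ψ v w| ≤ C)
    (h0 : ∀ v, ∫ w, ψ v w ∂ν = 0) {c : ℕ → ℝ} (hc : Summable fun n => c n ^ 2) :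
    ∀ᵐ ω ∂P, ∃ S, Tendsto (fun n => ∑ i ∈ Finset.range n, c i * ψ (V i ω) (W i ω)) atTop
      (𝓝 S) := by
  set D : ℕ → Ω → ℝ := fun i ω => ψ (V i ω) (W i ω) with hD
  set M : ℕ → Ω → ℝ := fun n ω => ∑ i ∈ Finset.range n, c i * D i ω with hM
  have hW' : ∀ n, Measurable (W n) := fun n => (hW n).mono (ℱ.le _) le_rfl
  have hDm : ∀ i, Measurable[ℱ (i + 1)] (D i) := fun i =>
    hψ.comp (((hV i).mono (ℱ.mono i.le_succ) le_rfl).prodMk (hW i))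
  have hDm' : ∀ i, Measurable (D i) := fun i => (hDm i).mono (ℱ.le _) le_rfl
  have hMm : ∀ n, Measurable[ℱ n] (M n) := fun n =>
    Finset.measurable_fun_sum _ fun i hi => ((hDm i).mono
      (ℱ.mono (Finset.mem_range.1 hi)) le_rfl).const_mul _
  have hMm' : ∀ n, Measurable (M n) := fun n => (hMm n).mono (ℱ.le _) le_rfl
  have hMb : ∀ n ω, |M n ω| ≤ ∑ i ∈ Finset.range n, |c i| * C := fun n ω =>
    (Finset.abs_sum_le_sum_abs _ _).trans (Finset.sum_le_sum fun i _ => by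
      rw [abs_mul]
      exact mul_le_mul_of_nonneg_left (hC _ _) (abs_nonneg _))
  have hMi : ∀ n, Integrable (M n) P := fun n => integrable_of_abs_le (hMm' n) _ (hMb n)
  have horth : ∀ n (U : Ω → ℝ) (K : ℝ), Measurable[ℱ n] U → (∀ ω, |U ω| ≤ K) →
      ∫ ω, U ω * D n ω ∂P = 0 := fun n U K hU hK =>
    integral_mul_eq_zero_of_indep (ℱ.le n) hU (hV n) (hW' n) (hind n) hψ hC hK
      (by simpa [hlaw n] using h0)
  have hMs : ∀ n, M (n + 1) = fun ω => M n ω + c n * D n ω := fun n => by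
    ext ω
    simp [hM, Finset.sum_range_succ]
  have hmart : Martingale M ℱ P := by
    refine martingale_of_condExp_sub_eq_zero_nat (fun n => (hMm n).stronglyMeasurable) hMi
      fun n => ?_
    refine (ae_eq_condExp_of_forall_setIntegral_eq (ℱ.le n) ((hMi _).sub (hMi _))
      (fun s _ _ => (integrable_zero _ _ _).integrableOn) ?_
      stronglyMeasurable_zero.aestronglyMeasurable).symm
    intro s hs _
    have hs' : MeasurableSet s := ℱ.le n _ hs
    have h1 := horth n (s.indicator fun _ => 1) 1 (measurable_const.indicator hs) fun ω => by
      by_cases h : ω ∈ s <;> simp [h]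
    have h2 : ∀ ω, s.indicator (M (n + 1) - M n) ω
        = c n * (s.indicator (fun _ => (1 : ℝ)) ω * D n ω) := fun ω => by
      by_cases h : ω ∈ s <;> simp [h, hMs n]
    rw [← integral_indicator hs', ← integral_indicator hs']
    simp_rw [h2]
    rw [integral_const_mul, h1]
    simp
  have hDi2 : ∀ n, Integrable (fun ω => D n ω ^ 2) P := fun n =>
    integrable_of_abs_le ((hDm' n).pow_const 2) (C ^ 2) fun ω => by
      rw [abs_pow]
      exact pow_le_pow_left₀ (abs_nonneg _) (hC _ _) 2
  have hDsq : ∀ n, ∫ ω, D n ω ^ 2 ∂P ≤ C ^ 2 := fun n => by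
    have h : ∀ ω, D n ω ^ 2 ≤ C ^ 2 := fun ω =>
      sq_le_sq' (abs_le.1 (hC _ _)).1 (abs_le.1 (hC _ _)).2
    calc ∫ ω, D n ω ^ 2 ∂P ≤ ∫ _, C ^ 2 ∂P :=
          integral_mono (hDi2 n) (integrable_const _) h
      _ = C ^ 2 := by simp
  have hsqi : ∀ n, Integrable (fun ω => M n ω ^ 2) P := fun n =>
    integrable_of_abs_le ((hMm' n).pow_const 2) _ fun ω => by
      rw [abs_pow]
      exact pow_le_pow_left₀ (abs_nonneg _) (hMb n ω) 2
  have hL2 : ∀ n, ∫ ω, M n ω ^ 2 ∂P ≤ (∑ i ∈ Finset.range n, c i ^ 2) * C ^ 2 := by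
    intro n
    induction n with
    | zero => simp [hM]
    | succ n ih =>
      have hi1 : Integrable (fun ω => M n ω * D n ω) P :=
        integrable_of_abs_le ((hMm' n).mul (hDm' n)) ((∑ i ∈ Finset.range n, |c i| * C) * C)
          fun ω => by
            rw [abs_mul]
            exact mul_le_mul (hMb n ω) (hC _ _) (abs_nonneg _) ((abs_nonneg _).trans (hMb n ω))
      have hexp : ∀ ω, M (n + 1) ω ^ 2
          = M n ω ^ 2 + 2 * c n * (M n ω * D n ω) + c n ^ 2 * D n ω ^ 2 := fun ω => by
        rw [hMs n]
        ring
      have hadd : ∫ ω, M (n + 1) ω ^ 2 ∂P = ∫ ω, M n ω ^ 2 ∂P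
          + 2 * c n * ∫ ω, M n ω * D n ω ∂P + c n ^ 2 * ∫ ω, D n ω ^ 2 ∂P := by
        simp_rw [hexp]
        have hi3 : Integrable (fun ω => M n ω ^ 2 + 2 * c n * (M n ω * D n ω)) P :=
          (hsqi n).add (hi1.const_mul _)
        rw [integral_add hi3 ((hDi2 n).const_mul _),
          integral_add (hsqi n) (hi1.const_mul _), integral_const_mul, integral_const_mul]
      rw [hadd, horth n (M n) _ (hMm n) (hMb n), Finset.sum_range_succ]
      nlinarith [mul_le_mul_of_nonneg_left (hDsq n) (sq_nonneg (c n))]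
  set R : ℝ := 1 + (∑' i, c i ^ 2) * C ^ 2 with hR
  refine hmart.submartingale.exists_ae_tendsto_of_bdd (R := R.toNNReal) fun n => ?_
  rw [eLpNorm_one_eq_lintegral_enorm, ← ofReal_integral_norm_eq_lintegral_enorm (hMi n)]
  refine ENNReal.ofReal_le_ofReal ?_
  calc ∫ ω, ‖M n ω‖ ∂P ≤ ∫ ω, (1 + M n ω ^ 2) ∂P :=
        integral_mono (hMi n).norm ((integrable_const _).add (hsqi n)) fun ω => by
          rw [Real.norm_eq_abs]
          nlinarith [sq_abs (M n ω), sq_nonneg (|M n ω| - 1), abs_nonneg (M n ω)]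
    _ = 1 + ∫ ω, M n ω ^ 2 ∂P := by
        rw [integral_add (integrable_const _) (hsqi n)]
        simp
    _ ≤ R := by
        have := hc.sum_le_tsum (Finset.range n) fun i _ => sq_nonneg (c i)
        nlinarith [hL2 n, mul_le_mul_of_nonneg_right this (sq_nonneg C)]

end Noise

/-! ### The number of visits to a set by an i.i.d. sample -/

section Count

open Classical in
/-- Hoeffding's inequality for the number of visits to a set of probability at most `p`. -/
lemma measureReal_count_ge_le {Ω E : Type*} [MeasurableSpace Ω] [MeasurableSpace E] {P : Measure Ω}
    [IsProbabilityMeasure P] {X : ℕ → Ω → E} (hX : ∀ n, Measurable (X n)) (hindep : iIndepFun X P)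
    {s : Set E} (hs : MeasurableSet s) {p : ℝ} (hp : ∀ i, P.real (X i ⁻¹' s) ≤ p) (n : ℕ) {τ : ℝ}
    (hτ : 0 ≤ τ) :
    P.real {ω | n * p + τ ≤ (((Finset.range n).filter (fun i => X i ω ∈ s)).card : ℝ)}
      ≤ Real.exp (-(2 * τ ^ 2 / n)) := by
  set Z : ℕ → Ω → ℝ := fun i ω => s.indicator (fun _ => (1 : ℝ)) (X i ω) with hZ
  have hZm : ∀ i, Measurable (Z i) := fun i => (measurable_const.indicator hs).comp (hX i)
  have hZint : ∀ i, P[Z i] = P.real (X i ⁻¹' s) := fun i => by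
    have : Z i = (X i ⁻¹' s).indicator fun _ => (1 : ℝ) := by
      ext ω
      simp [hZ, Set.indicator_apply]
    rw [this, integral_indicator_const _ (hX i hs)]
    simp
  have hsub : ∀ i, HasSubgaussianMGF (fun ω => Z i ω - P[Z i]) ((‖(1 : ℝ) - 0‖₊ / 2) ^ 2) P :=
    fun i => hasSubgaussianMGF_of_mem_Icc (hZm i).aemeasurable (ae_of_all _ fun ω => by
      by_cases h : X i ω ∈ s <;> simp [hZ, h])
  have hind : iIndepFun (fun i ω => Z i ω - P[Z i]) P :=
    hindep.comp (fun i z => s.indicator (fun _ => (1 : ℝ)) z - ∫ ω, Z i ω ∂P)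
      fun i => (measurable_const.indicator hs).sub_const _
  have hoeff := HasSubgaussianMGF.measure_sum_range_ge_le_of_iIndepFun hind (n := n)
    (fun i _ => hsub i) hτ
  have hcount : ∀ ω, (((Finset.range n).filter (fun i => X i ω ∈ s)).card : ℝ)
      = ∑ i ∈ Finset.range n, Z i ω := fun ω => by
    simp [hZ, Set.indicator_apply]
  refine (measureReal_mono fun ω hω => ?_).trans (hoeff.trans_eq ?_)
  · simp only [Set.mem_ofPred_eq, hcount] at hω ⊢
    rw [Finset.sum_sub_distrib]
    have : ∑ i ∈ Finset.range n, P[Z i] ≤ n * p := by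
      refine (Finset.sum_le_sum fun i _ => (hZint i).trans_le (hp i)).trans_eq ?_
      simp
    linarith
  · congr 1
    simp only [sub_zero, nnnorm_one, NNReal.coe_pow, NNReal.coe_div, NNReal.coe_one,
      NNReal.coe_ofNat]
    rcases eq_or_ne (n : ℝ) 0 with h | h
    · simp [h]
    · field_simp

open Classical in
/-- The law of large numbers for the frequency of visits to a set. -/
lemma ae_tendsto_count_div {Ω E : Type*} [MeasurableSpace Ω] [MeasurableSpace E] {P : Measure Ω}
    [IsProbabilityMeasure P] {X : ℕ → Ω → E} (hX : ∀ n, Measurable (X n)) (hindep : iIndepFun X P)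
    {μ : Measure E} (hlaw : ∀ n, P.map (X n) = μ) {s : Set E} (hs : MeasurableSet s) :
    ∀ᵐ ω ∂P, Tendsto
      (fun n : ℕ => (((Finset.range n).filter (fun i => X i ω ∈ s)).card : ℝ) / n) atTop
      (𝓝 (μ.real s)) := by
  have hφ : Measurable (s.indicator fun _ => (1 : ℝ)) := measurable_const.indicator hs
  have hint : ∫ ω, s.indicator (fun _ => (1 : ℝ)) (X 0 ω) ∂P = μ.real s := by
    rw [← integral_map (hX 0).aemeasurable hφ.aestronglyMeasurable, hlaw,
      integral_indicator_const _ hs]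
    simp
  have hslln := strong_law_ae_real (μ := P) (fun i ω => s.indicator (fun _ => (1 : ℝ)) (X i ω))
    (integrable_of_abs_le (hφ.comp (hX 0)) 1 fun ω => by
      by_cases h : X 0 ω ∈ s <;> simp [h])
    (fun i j hij => (hindep.indepFun hij).comp hφ hφ)
    (fun i => (IdentDistrib.mk (hX i).aemeasurable (hX 0).aemeasurable
      (by rw [hlaw, hlaw])).comp hφ)
  filter_upwards [hslln] with ω hω
  rw [← hint]
  refine hω.congr fun n => ?_
  simp [Set.indicator_apply]

end Count

/-! ### The mass of the ball of nearest neighbours -/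

section BallMass

variable {E : Type*} [PseudoEMetricSpace E] [MeasurableSpace E]

/-- The probability that the input lies within distance `r` of `x`; the radius may be infinite. -/
noncomputable def ballMass (μ : Measure E) (x : E) (r : ℝ≥0∞) : ℝ :=
  μ.real (Metric.closedEBall x r)

lemma ballMass_mono (μ : Measure E) [IsFiniteMeasure μ] (x : E) : Monotone (ballMass μ x) :=
  fun _ _ h => measureReal_mono (Metric.closedEBall_subset_closedEBall h)

lemma measurableSet_ballMass_lt [OpensMeasurableSpace E] (μ : Measure E) [IsFiniteMeasure μ] (x : E)
    (q : ℝ) :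
    MeasurableSet {z | ballMass μ x (edist z x) < q} :=
  measurableSet_lt ((ballMass_mono μ x).measurable.comp measurable_edist_left) measurable_const

/-- The ball around `x` reaching up to a random input has mass less than `q` with probability at
most `q`: the distribution function of a variable, evaluated at the variable itself, is
stochastically at least uniform. -/
lemma measureReal_ballMass_lt_le (μ : Measure E) [IsFiniteMeasure μ] (x : E) {q : ℝ} (hq : 0 ≤ q) :
    μ.real {z | ballMass μ x (edist z x) < q} ≤ q := by
  set I : Set ℝ≥0∞ := {r | ballMass μ x r < q} with hI
  rcases I.eq_empty_or_nonempty with h0 | hne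
  · have : {z | ballMass μ x (edist z x) < q} = ∅ := by
      ext z
      have : edist z x ∉ I := by simp [h0]
      simpa [hI] using this
    simpa [this] using hq
  obtain ⟨u, hu, huI, hcov⟩ : ∃ u : ℕ → ℝ≥0∞, Monotone u ∧ (∀ n, u n ∈ I) ∧
      ∀ r ∈ I, ∃ n, r ≤ u n := by
    by_cases hs : sSup I ∈ I
    · exact ⟨fun _ => sSup I, monotone_const, fun _ => hs, fun r hr => ⟨0, le_sSup hr⟩⟩
    · obtain ⟨u, hu, -, hlim, huI⟩ := (isLUB_sSup I).exists_seq_monotone_tendsto hne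
      refine ⟨u, hu, huI, fun r hr => ?_⟩
      have hlt : r < sSup I := lt_of_le_of_ne (le_sSup hr) fun h => hs (h ▸ hr)
      obtain ⟨n, hn⟩ := (hlim.eventually_const_le hlt).exists
      exact ⟨n, hn⟩
  have hsub : {z | ballMass μ x (edist z x) < q} ⊆ ⋃ n, Metric.closedEBall x (u n) := fun z hz => by
    obtain ⟨n, hn⟩ := hcov _ hz
    exact Set.mem_iUnion.2 ⟨n, Metric.mem_closedEBall.2 hn⟩
  have hmono : Monotone fun n => Metric.closedEBall x (u n) := fun i j h =>
    Metric.closedEBall_subset_closedEBall (hu h)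
  refine ENNReal.toReal_le_of_le_ofReal hq ((measure_mono hsub).trans ?_)
  rw [hmono.measure_iUnion]
  exact iSup_le fun n => (ENNReal.le_ofReal_iff_toReal_le (measure_ne_top _ _) hq).2 (huI n).le

open Classical in
/-- The ball of the `k` nearest neighbours of `x` has mass at least `q` when fewer than `k` of the
inputs `z` are such that the ball reaching up to `z` has mass less than `q`. -/
lemma le_ballMass_orderStat {μ : Measure E} [IsProbabilityMeasure μ] {x : E} {q : ℝ} (hq : q ≤ 1)
    {xs : ℕ → E} {k n : ℕ}
    (h : ((Finset.range n).filter
      (fun i => xs i ∈ {z | ballMass μ x (edist z x) < q})).card < k) :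
    q ≤ ballMass μ x (orderStat (fun i => edist (xs i) x) k n) := by
  rcases exists_le_orderStat (u := fun i => edist (xs i) x)
    (s := {i | ballMass μ x (edist (xs i) x) < q}) h with h1 | ⟨i, hi, hle⟩
  · simpa [h1, ballMass] using hq
  · exact (not_lt.1 hi).trans (ballMass_mono μ x hle)

end BallMass

/-! ### Asymptotics of the number of neighbours -/

lemma numNeighbours_le {β : ℝ} (n : ℕ) : (numNeighbours β n : ℝ) ≤ (n : ℝ) ^ β :=
  Nat.floor_le (by positivity)

lemma half_rpow_le_numNeighbours {β : ℝ} (hβ : 0 ≤ β) (n : ℕ) :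
    ((n + 1 : ℕ) : ℝ) ^ β / 2 ≤ numNeighbours β (n + 1) := by
  have h1 : (1 : ℝ) ≤ ((n + 1 : ℕ) : ℝ) ^ β :=
    Real.one_le_rpow (by push_cast; linarith [n.cast_nonneg (α := ℝ)]) hβ
  have h2 := Nat.lt_floor_add_one (((n + 1 : ℕ) : ℝ) ^ β)
  have h3 : (1 : ℝ) ≤ numNeighbours β (n + 1) := by
    exact_mod_cast (Nat.one_le_floor_iff _).2 h1
  change _ < (numNeighbours β (n + 1) : ℝ) + 1 at h2
  linarith

/-- The number of neighbours is negligible with respect to the sample size. -/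
lemma eventually_numNeighbours_le {β : ℝ} (hβ : β < 1) {c : ℝ} (hc : 0 < c) :
    ∀ᶠ n : ℕ in atTop, (numNeighbours β (n + 1) : ℝ) ≤ c * n := by
  have hlim : Tendsto (fun n : ℕ => ((n + 1 : ℕ) : ℝ) ^ (-(1 - β))) atTop (𝓝 0) :=
    (tendsto_rpow_neg_atTop (by linarith)).comp
      (tendsto_natCast_atTop_atTop.comp (tendsto_add_atTop_nat 1))
  filter_upwards [hlim.eventually_le_const (half_pos hc), eventually_ge_atTop 1] with n hn h1
  have h1' : (1 : ℝ) ≤ n := by exact_mod_cast h1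
  have hpos : (0 : ℝ) < ((n + 1 : ℕ) : ℝ) := by positivity
  have hsplit : ((n + 1 : ℕ) : ℝ) ^ β = ((n + 1 : ℕ) : ℝ) ^ (-(1 - β)) * ((n + 1 : ℕ) : ℝ) := by
    conv_rhs => rw [← Real.rpow_add_one hpos.ne']
    congr 1
    ring
  refine (numNeighbours_le _).trans ?_
  rw [hsplit]
  refine (mul_le_mul_of_nonneg_right hn hpos.le).trans ?_
  push_cast
  nlinarith

/-- The Hoeffding bounds with deviation `(n + 1) ^ β / 4` are summable, because `2 β > 1`. -/
lemma summable_exp_neg_rpow {β : ℝ} (hβ : 1 / 2 < β) :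
    Summable fun n : ℕ => Real.exp (-(2 * (((n + 1 : ℕ) : ℝ) ^ β / 4) ^ 2 / n)) := by
  refine summable_of_isBigO_nat (Real.summable_nat_rpow.2 (show (-2 : ℝ) < -1 by norm_num)) ?_
  have hδ : 0 < 2 * β - 1 := by linarith
  have h1 := ((isLittleO_exp_neg_mul_rpow_atTop (show (0 : ℝ) < 1 / 8 by norm_num)
    (-2 / (2 * β - 1))).comp_tendsto ((tendsto_rpow_atTop hδ).comp
      tendsto_natCast_atTop_atTop)).isBigO
  have h2 : (fun n : ℕ => Real.exp (-(2 * (((n + 1 : ℕ) : ℝ) ^ β / 4) ^ 2 / n)))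
      =O[atTop] fun n : ℕ => Real.exp (-(1 / 8) * (n : ℝ) ^ (2 * β - 1)) := by
    refine Asymptotics.IsBigO.of_bound 1 ?_
    filter_upwards [eventually_ge_atTop 1] with n hn
    have hn' : (0 : ℝ) < n := by exact_mod_cast hn
    rw [one_mul, Real.norm_of_nonneg (Real.exp_nonneg _), Real.norm_of_nonneg (Real.exp_nonneg _),
      Real.exp_le_exp]
    have h3 : (n : ℝ) ^ (2 * β - 1) * n = ((n : ℝ) ^ β) ^ 2 := by
      rw [← Real.rpow_add_one hn'.ne', ← Real.rpow_natCast, ← Real.rpow_mul hn'.le]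
      congr 1
      push_cast
      ring
    have h4 : (n : ℝ) ^ β ≤ ((n + 1 : ℕ) : ℝ) ^ β :=
      Real.rpow_le_rpow hn'.le (by push_cast; linarith) (by linarith)
    have h5 : 0 ≤ (n : ℝ) ^ β := by positivity
    have h6 : 1 / 8 * (n : ℝ) ^ (2 * β - 1) ≤ 2 * (((n + 1 : ℕ) : ℝ) ^ β / 4) ^ 2 / n := by
      rw [le_div_iff₀ hn', mul_assoc, h3]
      nlinarith [pow_le_pow_left₀ h5 h4 2]
    linarith
  refine h2.trans (h1.congr' (Eventually.of_forall fun n => rfl) ?_)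
  filter_upwards [eventually_ge_atTop 1] with n hn
  have hn' : (0 : ℝ) ≤ n := by positivity
  simp only [Function.comp_apply]
  rw [← Real.rpow_mul hn']
  congr 1
  field_simp

section Radius

variable {Ω E : Type*} [MeasurableSpace Ω] [PseudoEMetricSpace E] [MeasurableSpace E]
  [OpensMeasurableSpace E] {P : Measure Ω} [IsProbabilityMeasure P] {X : ℕ → Ω → E} {μ : Measure E}

/-- The ball of the nearest neighbours has mass of order at least `n ^ (β - 1)`: otherwise at least
`k_{n+1} ≥ (n + 1) ^ β / 2` of the first `n` inputs would fall in a set where no more than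
`(n + 1) ^ β / 4` of them are expected, and this deviation is large compared with `n ^ (1/2)`. -/
theorem ae_eventually_le_ballMass [IsProbabilityMeasure μ] (hX : ∀ n, Measurable (X n))
    (hindep : iIndepFun X P) (hlaw : ∀ n, P.map (X n) = μ) (x : E) {β : ℝ} (hβ : 1 / 2 < β)
    (hβ' : β < 1) :
    ∀ᵐ ω ∂P, ∀ᶠ n : ℕ in atTop, ((n + 1 : ℕ) : ℝ) ^ (β - 1) / 4
      ≤ ballMass μ x (orderStat (fun i => edist (X i ω) x) (numNeighbours β (n + 1)) n) := by
  classical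
  set q : ℕ → ℝ := fun n => ((n + 1 : ℕ) : ℝ) ^ (β - 1) / 4 with hq
  set s : ℕ → Set E := fun n => {z | ballMass μ x (edist z x) < q n} with hs
  set A : ℕ → Set Ω := fun n => {ω | n * q n + ((n + 1 : ℕ) : ℝ) ^ β / 4
    ≤ (((Finset.range n).filter (fun i => X i ω ∈ s n)).card : ℝ)} with hA
  have hsm : ∀ n, MeasurableSet (s n) := fun n => measurableSet_ballMass_lt μ x (q n)
  have hle : ∀ n, P.real (A n)
      ≤ Real.exp (-(2 * (((n + 1 : ℕ) : ℝ) ^ β / 4) ^ 2 / n)) := fun n =>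
    measureReal_count_ge_le hX hindep (hsm n) (fun i => by
      rw [← map_measureReal_apply (hX i) (hsm n), hlaw]
      exact measureReal_ballMass_lt_le μ x (by positivity)) n (by positivity)
  have hsum : ∑' n, P (A n) ≠ ∞ := by
    refine ne_top_of_le_ne_top (summable_exp_neg_rpow hβ).tsum_ofReal_ne_top
      (ENNReal.tsum_le_tsum fun n => ?_)
    rw [← ofReal_measureReal]
    exact ENNReal.ofReal_le_ofReal (hle n)
  filter_upwards [ae_eventually_notMem hsum] with ω hω
  filter_upwards [hω] with n hn
  have hpos : (0 : ℝ) < ((n + 1 : ℕ) : ℝ) := by positivity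
  have hone : (1 : ℝ) ≤ ((n + 1 : ℕ) : ℝ) := by exact_mod_cast Nat.le_add_left 1 n
  refine le_ballMass_orderStat ?_ ?_
  · have : ((n + 1 : ℕ) : ℝ) ^ (β - 1) ≤ 1 :=
      Real.rpow_le_one_of_one_le_of_nonpos hone (by linarith)
    linarith
  · simp only [hA, Set.mem_ofPred_eq, not_le] at hn
    have h2 : n * q n ≤ ((n + 1 : ℕ) : ℝ) ^ β / 4 := by
      have : ((n + 1 : ℕ) : ℝ) ^ β = ((n + 1 : ℕ) : ℝ) ^ (β - 1) * ((n + 1 : ℕ) : ℝ) := by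
        rw [← Real.rpow_add_one hpos.ne']
        congr 1
        ring
      have h0 : 0 ≤ ((n + 1 : ℕ) : ℝ) ^ (β - 1) := by positivity
      rw [this]
      simp only [hq]
      push_cast at h0 ⊢
      nlinarith
    have h3 := half_rpow_le_numNeighbours (by linarith : 0 ≤ β) n
    have h4 : (((Finset.range n).filter (fun i => X i ω ∈ s n)).card : ℝ)
        < numNeighbours β (n + 1) := by linarith
    exact_mod_cast h4

/-- The distance to the nearest neighbours tends to zero, by the law of large numbers. -/
theorem ae_tendsto_orderStat (hX : ∀ n, Measurable (X n)) (hindep : iIndepFun X P)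
    (hlaw : ∀ n, P.map (X n) = μ) {x : E} (hx : x ∈ μ.support) {β : ℝ} (hβ : β < 1) :
    ∀ᵐ ω ∂P, Tendsto
      (fun n => orderStat (fun i => edist (X i ω) x) (numNeighbours β (n + 1)) n)
      atTop (𝓝 0) := by
  classical
  have : IsProbabilityMeasure μ := hlaw 0 ▸ Measure.isProbabilityMeasure_map (hX 0).aemeasurable
  have hball : ∀ j : ℕ, ∀ᵐ ω ∂P, ∀ᶠ n in atTop,
      orderStat (fun i => edist (X i ω) x) (numNeighbours β (n + 1)) n ≤ (j : ℝ≥0∞)⁻¹ := by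
    intro j
    set s := Metric.closedEBall x (j : ℝ≥0∞)⁻¹ with hs
    have hp : 0 < μ.real s := ENNReal.toReal_pos
      ((Measure.mem_support_iff_forall x).1 hx s
        (Metric.closedEBall_mem_nhds x (by simp))).ne' (measure_ne_top _ _)
    filter_upwards [ae_tendsto_count_div hX hindep hlaw (s := s)
      Metric.isClosed_closedEBall.measurableSet] with ω hω
    filter_upwards [hω.eventually_const_le (half_lt_self hp),
      eventually_numNeighbours_le hβ (half_pos hp), eventually_ge_atTop 1] with n h1 h2 h3
    have h3' : (0 : ℝ) < n := by exact_mod_cast h3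
    rw [le_div_iff₀ h3'] at h1
    simp only [hs, Metric.mem_closedEBall] at h1 h2
    exact orderStat_le (by exact_mod_cast h2.trans h1)
  filter_upwards [ae_all_iff.2 hball] with ω hω
  rw [ENNReal.tendsto_nhds_zero]
  intro r hr
  obtain ⟨j, hj⟩ := ENNReal.exists_inv_nat_lt hr.ne'
  filter_upwards [hω j] with n hn using hn.trans hj.le

end Radius

/-! ### The quantile as a sign change -/

lemma cdf_lt_of_lt_quantile {ν : Measure ℝ} {α t : ℝ} (hα : 0 < α) (ht : t < quantile ν α) :
    cdf ν t < α := by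
  by_contra! h
  have hmem : t ∈ {s : ℝ | α ≤ cdf ν s} := h
  obtain ⟨b, hb⟩ := eventually_atBot.1 ((tendsto_cdf_atBot ν).eventually_lt_const hα)
  refine absurd (csInf_le ⟨b, fun s hs => ?_⟩ hmem) (not_le.2 ht)
  rw [Set.mem_ofPred_eq] at hs
  by_contra! hlt
  exact absurd hs (not_le.2 (hb s hlt.le))

/-! ### Increments of the algorithm -/

section Increment

variable {d m : ℕ}

/-- The increment of the algorithm, up to the factor `-γ_{n+1}`, as a function of the state
`v = (radius of the neighbourhood, current estimate)` and the fresh observation `w = (input, seed)`. -/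
noncomputable def increment (g : EuclideanSpace ℝ (Fin d) → EuclideanSpace ℝ (Fin m) → ℝ)
    (α : ℝ) (x : EuclideanSpace ℝ (Fin d)) (v : ℝ≥0∞ × ℝ)
    (w : EuclideanSpace ℝ (Fin d) × EuclideanSpace ℝ (Fin m)) : ℝ :=
  ((if g w.1 w.2 ≤ v.2 then 1 else 0) - α) * (if edist w.1 x ≤ v.1 then 1 else 0)

/-- The mean of the increment over a fresh observation, for a frozen state. -/
noncomputable def meanIncrement (μX : Measure (EuclideanSpace ℝ (Fin d)))
    (με : Measure (EuclideanSpace ℝ (Fin m)))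
    (g : EuclideanSpace ℝ (Fin d) → EuclideanSpace ℝ (Fin m) → ℝ)
    (α : ℝ) (x : EuclideanSpace ℝ (Fin d)) (v : ℝ≥0∞ × ℝ) : ℝ :=
  ∫ w, increment g α x v w ∂(μX.prod με)

variable {μX : Measure (EuclideanSpace ℝ (Fin d))} {με : Measure (EuclideanSpace ℝ (Fin m))}
  {g : EuclideanSpace ℝ (Fin d) → EuclideanSpace ℝ (Fin m) → ℝ} {α : ℝ}
  {x : EuclideanSpace ℝ (Fin d)}

lemma measurable_increment (hg : Measurable (Function.uncurry g)) :
    Measurable (Function.uncurry (increment g α x)) := by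
  have hY : Measurable fun p : (ℝ≥0∞ × ℝ) ×
      (EuclideanSpace ℝ (Fin d) × EuclideanSpace ℝ (Fin m)) => g p.2.1 p.2.2 :=
    hg.comp measurable_snd
  have hd : Measurable fun p : (ℝ≥0∞ × ℝ) ×
      (EuclideanSpace ℝ (Fin d) × EuclideanSpace ℝ (Fin m)) => edist p.2.1 x :=
    measurable_edist_left.comp (measurable_fst.comp measurable_snd)
  exact ((Measurable.ite (measurableSet_le hY (measurable_snd.comp measurable_fst))
    measurable_const measurable_const).sub_const α).mul
    (Measurable.ite (measurableSet_le hd (measurable_fst.comp measurable_fst))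
      measurable_const measurable_const)

lemma abs_increment_le (hα : 0 ≤ α) (hα' : α ≤ 1) (v : ℝ≥0∞ × ℝ)
    (w : EuclideanSpace ℝ (Fin d) × EuclideanSpace ℝ (Fin m)) : |increment g α x v w| ≤ 1 := by
  unfold increment
  split_ifs <;> simp [abs_le] <;> (try constructor) <;> linarith

variable [IsProbabilityMeasure μX] [IsProbabilityMeasure με]

lemma measurable_meanIncrement (hg : Measurable (Function.uncurry g)) :
    Measurable (meanIncrement μX με g α x) :=
  (StronglyMeasurable.integral_prod_right
    (measurable_increment (α := α) (x := x) hg).stronglyMeasurable).measurable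

lemma integrable_increment (hg : Measurable (Function.uncurry g)) (hα : 0 ≤ α) (hα' : α ≤ 1)
    (v : ℝ≥0∞ × ℝ) : Integrable (increment g α x v) (μX.prod με) :=
  integrable_of_abs_le ((measurable_increment hg).comp measurable_prodMk_left) 1
    (abs_increment_le hα hα' v)

lemma abs_meanIncrement_le (hα : 0 ≤ α) (hα' : α ≤ 1) (v : ℝ≥0∞ × ℝ) :
    |meanIncrement μX με g α x v| ≤ 1 := by
  have := norm_integral_le_of_norm_le_const (μ := μX.prod με)
    (f := increment g α x v) (C := 1) (ae_of_all _ fun w => abs_increment_le hα hα' v w)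
  simpa [meanIncrement] using this

/-- The mean increment is the mass of the neighbourhood times the value at the current estimate of
the distribution function of the output given that the input is a neighbour, minus `α`. -/
lemma meanIncrement_eq (hg : Measurable (Function.uncurry g)) {r : ℝ≥0∞} (hr : r ≠ ⊤)
    (hpos : 0 < ballMass μX x r) (t : ℝ) :
    meanIncrement μX με g α x (r, t)
      = ballMass μX x r * (cdf (lawOn μX με g (Metric.closedBall x r.toReal)) t - α) := by
  have hball : Metric.closedBall x r.toReal = Metric.closedEBall x r := by
    ext z
    rw [Metric.mem_closedBall, Metric.mem_closedEBall, edist_dist,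
      ENNReal.ofReal_le_iff_le_toReal hr]
  set B := Metric.closedEBall x r with hB
  have hBm : MeasurableSet B := Metric.isClosed_closedEBall.measurableSet
  set A : Set (EuclideanSpace ℝ (Fin d) × EuclideanSpace ℝ (Fin m)) := Prod.fst ⁻¹' B with hA
  have hAm : MeasurableSet A := measurable_fst hBm
  set T : Set (EuclideanSpace ℝ (Fin d) × EuclideanSpace ℝ (Fin m)) :=
    (fun p => g p.1 p.2) ⁻¹' Set.Iic t with hT
  have hgm : Measurable fun p : EuclideanSpace ℝ (Fin d) × EuclideanSpace ℝ (Fin m) =>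
    g p.1 p.2 := hg
  have hTm : MeasurableSet T := hgm measurableSet_Iic
  have hmass : (μX.prod με).real A = ballMass μX x r := by
    have : (μX.prod με).map Prod.fst = μX := by simp
    rw [ballMass, ← hB, ← map_measureReal_apply measurable_fst hBm, this]
  have hA0 : (μX.prod με) A ≠ 0 := fun h => by
    rw [← hmass, measureReal_def, h] at hpos
    simp at hpos
  have : IsProbabilityMeasure (ProbabilityTheory.cond (μX.prod με) A) :=
    cond_isProbabilityMeasure hA0
  have hlaw : lawOn μX με g (Metric.closedBall x r.toReal)
      = (ProbabilityTheory.cond (μX.prod με) A).map fun p => g p.1 p.2 := by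
    rw [lawOn, hball]
  have : IsProbabilityMeasure (lawOn μX με g (Metric.closedBall x r.toReal)) :=
    hlaw ▸ Measure.isProbabilityMeasure_map hgm.aemeasurable
  have hcdf : ballMass μX x r * cdf (lawOn μX με g (Metric.closedBall x r.toReal)) t
      = (μX.prod με).real (A ∩ T) := by
    rw [cdf_eq_real, hlaw, map_measureReal_apply hgm measurableSet_Iic, measureReal_def,
      cond_apply hAm, ENNReal.toReal_mul, ENNReal.toReal_inv, ← measureReal_def, ← measureReal_def,
      ← hmass]
    rw [← hmass] at hpos
    field_simp
    rfl
  have hinc : ∀ w, increment g α x (r, t) w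
      = (A ∩ T).indicator (fun _ => (1 : ℝ)) w - α * A.indicator (fun _ => (1 : ℝ)) w := by
    classical
    intro w
    have h1 : w ∈ A ↔ edist w.1 x ≤ r := by simp [hA, hB]
    have h2 : w ∈ T ↔ g w.1 w.2 ≤ t := by simp [hT]
    simp only [increment, Set.indicator_apply, Set.mem_inter_iff, h1, h2]
    by_cases h3 : edist w.1 x ≤ r <;> by_cases h4 : g w.1 w.2 ≤ t <;> simp [h3, h4]
  rw [mul_sub, hcdf, meanIncrement]
  simp_rw [hinc]
  rw [integral_sub ((integrable_const _).indicator (hAm.inter hTm))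
    (((integrable_const _).indicator hAm).const_mul _), integral_const_mul,
    integral_indicator_const _ (hAm.inter hTm), integral_indicator_const _ hAm, hmass]
  simp [mul_comm]

end Increment

/-! ### Measurability of the iterates -/

section Measurability

variable {Ω : Type*} [MeasurableSpace Ω] {d : ℕ} {X : ℕ → Ω → EuclideanSpace ℝ (Fin d)}

lemma measurable_orderStat_edist {n : ℕ} (k : ℕ) (x : EuclideanSpace ℝ (Fin d))
    (hX : ∀ i < n, Measurable (X i)) :
    Measurable fun ω => orderStat (fun i => edist (X i ω) x) k n :=
  measurable_orderStat fun i hi => measurable_edist_left.comp (hX i hi)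

lemma measurable_iterate {Y : ℕ → Ω → ℝ} (α β γ θ₀ : ℝ) (x : EuclideanSpace ℝ (Fin d)) (n : ℕ)
    (hX : ∀ i < n, Measurable (X i)) (hY : ∀ i < n, Measurable (Y i)) :
    Measurable fun ω => iterate α β γ θ₀ x (fun i => X i ω) (fun i => Y i ω) n := by
  classical
  induction n with
  | zero => exact measurable_const
  | succ n ih =>
    have hθ := ih (fun i hi => hX i (hi.trans n.lt_succ_self)) fun i hi =>
      hY i (hi.trans n.lt_succ_self)
    have hN : MeasurableSet {ω | IsNeighbour β x (fun i => X i ω) n} :=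
      measurableSet_le (measurable_edist_left.comp (hX n n.lt_succ_self))
        (measurable_orderStat_edist _ x fun i hi => hX i (hi.trans n.lt_succ_self))
    exact hθ.sub ((((Measurable.ite (measurableSet_le (hY n n.lt_succ_self) hθ) measurable_const
      measurable_const).sub_const α).const_mul _).mul
        (Measurable.ite hN measurable_const measurable_const))

end Measurability

/-- The filtration whose `n`-th σ-algebra is generated by the first `n` observations. -/
def pastFiltration {Ω 𝓦 : Type*} [mΩ : MeasurableSpace Ω] [MeasurableSpace 𝓦] (W : ℕ → Ω → 𝓦)
    (hW : ∀ n, Measurable (W n)) : Filtration ℕ mΩ where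
  seq n := ⨆ i ∈ Set.Iio n, MeasurableSpace.comap (W i) inferInstance
  mono' _ _ h := biSup_mono fun _ hi => lt_of_lt_of_le hi h
  le' _ := iSup₂_le fun i _ => (hW i).comap_le

section Past

variable {Ω 𝓦 : Type*} [mΩ : MeasurableSpace Ω] [MeasurableSpace 𝓦] {W : ℕ → Ω → 𝓦}
  (hW : ∀ n, Measurable (W n))

lemma measurable_pastFiltration {i n : ℕ} (hi : i < n) :
    Measurable[pastFiltration W hW n] (W i) :=
  measurable_iff_comap_le.2
    (le_iSup₂ (f := fun i (_ : i ∈ Set.Iio n) => MeasurableSpace.comap (W i) inferInstance) i hi)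

lemma indep_pastFiltration {P : Measure Ω} (hindep : iIndepFun W P) (n : ℕ) :
    Indep (pastFiltration W hW n) (MeasurableSpace.comap (W n) inferInstance) P := by
  have := indep_iSup_of_disjoint (fun i => (hW i).comap_le) hindep.iIndep
    (S := Set.Iio n) (T := {n}) (by simp)
  rw [iSup_singleton] at this
  exact this

end Past

lemma tendsto_sum_stepSize_mul_atTop {β γ c : ℝ} {p : ℕ → ℝ} (hγβ : γ ≤ β) (hc : 0 < c)
    (hp : ∀ n, 0 ≤ p n) (h : ∀ᶠ n : ℕ in atTop, c * ((n + 1 : ℕ) : ℝ) ^ (β - 1) ≤ p n) :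
    Tendsto (fun n => ∑ i ∈ Finset.range n, stepSize γ (i + 1) * p i) atTop atTop := by
  have hs : ∀ n, 0 ≤ stepSize γ n := fun n => Real.rpow_nonneg n.cast_nonneg _
  rw [← not_summable_iff_tendsto_nat_atTop_of_nonneg fun n => mul_nonneg (hs _) (hp n)]
  intro hsum
  have h1 : Summable fun n : ℕ => c * ((n + 1 : ℕ) : ℝ) ^ (β - 1 - γ) := by
    refine hsum.of_norm_bounded_eventually_nat ?_
    filter_upwards [h] with n hn
    rw [Real.norm_of_nonneg (by positivity)]
    refine le_of_eq_of_le ?_ (mul_le_mul_of_nonneg_left hn (hs _))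
    rw [sub_eq_add_neg _ γ, Real.rpow_add (by positivity), stepSize]
    ring
  have h2 : Summable fun n : ℕ => (n : ℝ) ^ (β - 1 - γ) :=
    (summable_nat_add_iff (f := fun n : ℕ => (n : ℝ) ^ (β - 1 - γ)) 1).1
      ((summable_mul_left_iff hc.ne').1 h1)
  have h3 := Real.summable_nat_rpow.1 h2
  linarith

lemma summable_stepSize_sq {γ : ℝ} (hγ : 1 / 2 < γ) :
    Summable fun n : ℕ => (-stepSize γ (n + 1)) ^ 2 := by
  have h := (summable_nat_add_iff (f := fun n : ℕ => (n : ℝ) ^ (-(2 * γ))) 1).2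
    (Real.summable_nat_rpow.2 (show -(2 * γ) < -1 by linarith))
  refine h.congr fun n => ?_
  rw [neg_sq, stepSize, ← Real.rpow_natCast, ← Real.rpow_mul (by positivity)]
  congr 1
  push_cast
  ring

end KNNQuantile

open KNNQuantile in
theorem theorem1 {Ω : Type*} [MeasurableSpace Ω] (P : Measure Ω) [IsProbabilityMeasure P]
    {d m : ℕ} (hd : 0 < d)
    -- the laws of the input and of the random seed, and the stochastic code
    (μX : Measure (EuclideanSpace ℝ (Fin d))) [IsProbabilityMeasure μX]
    (με : Measure (EuclideanSpace ℝ (Fin m))) [IsProbabilityMeasure με]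
    (g : EuclideanSpace ℝ (Fin d) → EuclideanSpace ℝ (Fin m) → ℝ)
    (hg : Measurable (Function.uncurry g))
    -- the i.i.d. sample of pairs (input, seed); within a pair, input and seed are independent
    (X : ℕ → Ω → EuclideanSpace ℝ (Fin d)) (ε : ℕ → Ω → EuclideanSpace ℝ (Fin m))
    (hX : ∀ n, Measurable (X n)) (hε : ∀ n, Measurable (ε n))
    (hlaw : ∀ n, P.map (fun ω => (X n ω, ε n ω)) = μX.prod με)
    (hindep : iIndepFun (fun n ω => (X n ω, ε n ω)) P)
    -- the level and the parameters of the algorithm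
    (α : ℝ) (hα : 1 / 2 ≤ α) (hα' : α < 1)
    (β γ : ℝ) (hγ : 1 / 2 < γ) (hγβ : γ ≤ β) (hβ : β < 1) (θ₀ : ℝ)
    -- the fixed input
    (x : EuclideanSpace ℝ (Fin d)) (hx : x ∈ μX.support)
    (hA1 : KNNQuantile.AssumptionA1 μX με g x)
    (hA2 : KNNQuantile.AssumptionA2 μX)
    -- the conditional quantile is the only one of level `α`
    (huniq : ∀ t : ℝ, KNNQuantile.quantile (KNNQuantile.lawAt με g x) α < t →
      α < cdf (KNNQuantile.lawAt με g x) t) :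
    ∀ᵐ ω ∂P, Tendsto
      (fun n => KNNQuantile.iterate α β γ θ₀ x (fun i => X i ω)
        (fun i => g (X i ω) (ε i ω)) n)
      atTop (𝓝 (KNNQuantile.quantile (KNNQuantile.lawAt με g x) α)) := by
  have hα0 : 0 ≤ α := by linarith
  set W : ℕ → Ω → EuclideanSpace ℝ (Fin d) × EuclideanSpace ℝ (Fin m) :=
    fun n ω => (X n ω, ε n ω) with hWdef
  have hW : ∀ n, Measurable (W n) := fun n => (hX n).prodMk (hε n)
  have hXlaw : ∀ n, P.map (X n) = μX := fun n => by
    have h1 : X n = Prod.fst ∘ W n := rfl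
    rw [h1, ← Measure.map_map measurable_fst (hW n), hlaw n]
    simp
  have hXind : iIndepFun X P := hindep.comp (fun _ => Prod.fst) fun _ => measurable_fst
  set θ : ℕ → Ω → ℝ := fun n ω =>
    iterate α β γ θ₀ x (fun i => X i ω) (fun i => g (X i ω) (ε i ω)) n with hθ
  set ρ : ℕ → Ω → ℝ≥0∞ := fun n ω =>
    orderStat (fun i => edist (X i ω) x) (numNeighbours β (n + 1)) n with hρ
  set ψ : ℝ≥0∞ × ℝ → EuclideanSpace ℝ (Fin d) × EuclideanSpace ℝ (Fin m) → ℝ :=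
    fun v w => increment g α x v w - meanIncrement μX με g α x v with hψ
  have hstep : ∀ n ω, θ (n + 1) ω
      = θ n ω - stepSize γ (n + 1) * increment g α x (ρ n ω, θ n ω) (W n ω) := fun n ω => by
    simp only [hθ, hρ, hWdef, iterate, increment, IsNeighbour, mul_assoc]
    congr
  -- The state `(ρ n, θ n)` depends on the first `n` observations only.
  have hVm : ∀ n, Measurable[pastFiltration W hW n] fun ω => (ρ n ω, θ n ω) := fun n => by
    have hXm : ∀ i < n, Measurable[pastFiltration W hW n] (X i) := fun i hi =>
      measurable_fst.comp (measurable_pastFiltration hW hi)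
    have hYm : ∀ i < n, Measurable[pastFiltration W hW n] fun ω => g (X i ω) (ε i ω) :=
      fun i hi => hg.comp (measurable_pastFiltration hW hi)
    exact (@measurable_orderStat_edist Ω (pastFiltration W hW n) d X n _ x hXm).prodMk
      (@measurable_iterate Ω (pastFiltration W hW n) d X _ α β γ θ₀ x n hXm hYm)
  have hnoise := ae_exists_tendsto_sum_noise (P := P) (pastFiltration W hW) hVm
    (fun n => measurable_pastFiltration hW n.lt_succ_self) hlaw
    (indep_pastFiltration hW hindep) (ψ := ψ)
    ((measurable_increment hg).sub ((measurable_meanIncrement hg).comp measurable_fst))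
    (C := 1 + 1)
    (fun v w => (abs_sub _ _).trans (add_le_add (abs_increment_le hα0 hα'.le v w)
      (abs_meanIncrement_le hα0 hα'.le v)))
    (fun v => by
      simp only [hψ]
      rw [integral_sub (integrable_increment hg hα0 hα'.le v) (integrable_const _)]
      simp [meanIncrement])
    (summable_stepSize_sq hγ)
  obtain ⟨M, hM⟩ := hA1
  -- A law with a density has no atom, so a ball of positive mass has positive radius.
  have hatom : ballMass μX x 0 = 0 := by
    have : Nonempty (Fin d) := ⟨⟨0, hd⟩⟩
    obtain ⟨f, -, hf, -⟩ := hA2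
    have hac : μX ≪ volume := hf ▸ withDensity_absolutelyContinuous _ _
    have h0 : Metric.closedEBall x 0 = {x} := by
      ext z
      simp
    rw [ballMass, h0, measureReal_def, hac (measure_singleton x), ENNReal.toReal_zero]
  filter_upwards [hnoise, ae_tendsto_orderStat hX hXind hXlaw hx hβ,
    ae_eventually_le_ballMass hX hXind hXlaw x (hγ.trans_le hγβ) hβ] with ω ⟨S, hS⟩ hρ0 hmass
  change Tendsto (fun n => ρ n ω) atTop (𝓝 0) at hρ0
  change ∀ᶠ n : ℕ in atTop, ((n + 1 : ℕ) : ℝ) ^ (β - 1) / 4 ≤ ballMass μX x (ρ n ω) at hmass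
  have hp0 : ∀ n, 0 ≤ ballMass μX x (ρ n ω) := fun n => measureReal_nonneg
  have hp1 : ∀ n, ballMass μX x (ρ n ω) ≤ 1 := fun n => measureReal_le_one
  have hs0 : ∀ n, 0 ≤ stepSize γ n := fun n => Real.rpow_nonneg n.cast_nonneg _
  have hppos : ∀ᶠ n in atTop, 0 < ballMass μX x (ρ n ω) := by
    filter_upwards [hmass] with n hn
    exact lt_of_lt_of_le (by positivity) hn
  have hfin : ∀ᶠ n in atTop, ρ n ω ≠ ⊤ :=
    (hρ0.eventually_lt_const (by simp : (0 : ℝ≥0∞) < ⊤)).mono fun n hn => hn.ne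
  have hρr : Tendsto (fun n => (ρ n ω).toReal) atTop (𝓝 0) := by
    simpa [Function.comp_def] using (ENNReal.tendsto_toReal ENNReal.zero_ne_top).comp hρ0
  have hslim : Tendsto (fun n : ℕ => stepSize γ (n + 1)) atTop (𝓝 0) :=
    (tendsto_rpow_neg_atTop (by linarith)).comp
      (tendsto_natCast_atTop_atTop.comp (tendsto_add_atTop_nat 1))
  refine tendsto_of_robbinsMonro (h := fun t => cdf (lawAt με g x) t - α)
    (a := fun n => stepSize γ (n + 1) * ballMass μX x (ρ n ω))
    (b := fun n => cdf (lawOn μX με g (Metric.closedBall x (ρ n ω).toReal)) (θ n ω) - α)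
    (fun s t hst => sub_le_sub_right (monotone_cdf _ hst) α)
    (fun t ht => sub_neg.2 (cdf_lt_of_lt_quantile (by linarith) ht))
    (fun t ht => sub_pos.2 (huniq t ht)) (fun n => mul_nonneg (hs0 _) (hp0 n)) ?_ ?_ ?_ ?_ ?_ hS
  · exact squeeze_zero (fun n => mul_nonneg (hs0 _) (hp0 n))
      (fun n => mul_le_of_le_one_right (hs0 _) (hp1 n)) hslim
  · refine tendsto_sum_stepSize_mul_atTop hγβ (show (0 : ℝ) < 1 / 4 by norm_num) hp0 ?_
    filter_upwards [hmass] with n hn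
    linarith
  · refine Eventually.of_forall fun n => abs_le.2 ⟨?_, ?_⟩
    · linarith [cdf_nonneg (lawOn μX με g (Metric.closedBall x (ρ n ω).toReal)) (θ n ω)]
    · linarith [cdf_le_one (lawOn μX με g (Metric.closedBall x (ρ n ω).toReal)) (θ n ω)]
  · refine squeeze_zero_norm' ?_ (by simpa using hρr.const_mul M)
    filter_upwards [hppos, hfin] with n hn hn'
    have hr : 0 < (ρ n ω).toReal := ENNReal.toReal_pos (fun h => by
      rw [h, hatom] at hn
      exact lt_irrefl _ hn) hn'
    rw [Real.norm_eq_abs, sub_sub_sub_cancel_right]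
    exact hM _ hr _
  · filter_upwards [hppos, hfin] with n hn hn'
    have h := meanIncrement_eq (με := με) (α := α) hg hn' hn (θ n ω)
    change θ (n + 1) ω = θ n ω - _ + _
    rw [hstep, mul_assoc (stepSize γ (n + 1)), ← h]
    simp only [hψ]
    ring
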